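/- Conventions. $\|\cdot\|_2$ is the spectral norm, $M^\dagger$ the Moore–Penrose pseudoinverse, and $\kappa_2(M)=\|M\|_2\|M^\dagger\|_2$ (applied to matrices of full rank). Floating-point computation with unit roundoff $u\ge 0$ follows the standard model without overflow or underflow: every elementary operation $+,-,\times,/,\sqrt{\ }$ returns its exact result times $1+\delta$ for some $|\delta|\le u$. For a constant $c>0$ put $$\widetilde\gamma_{k}^{(QR)}=\frac{c\,k\,u_{QR}}{1-c\,k\,u_{QR}} .$$ **Theorem.** There is an absolute constant $c>0$ such that the following holds for all integers $m,s\ge 0$, $n\ge 1$ and all $u_{QR}\ge 0$ with $c\,sn\,u_{QR}<1$. Let $A\in\mathbb R^{m\times n}$ and $\Omega\in\mathbb R^{s\times m}$ be such that $A$ and $\Omega A$ have rank $n$, and let $\Omega A=QR$ be an economic QR decomposition ($Q\in\mathbb R^{s\times n}$ with orthonormal columns, $R\in\mathbb R^{n\times n}$ upper triangular). Let $\widehat Y=\Omega A+\Delta_s$ be the computed sketch, where $\Delta_s\in\mathbb R^{s\times n}$ is an arbitrary error matrix (accounting for the errors in casting $A$ to, and sketching in, a precision $u_s$), and let $\widehat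 R\in\mathbb R^{n\times n}$ be a computed triangular factor of the economic Householder QR decomposition of $\widehat Y$ carried out in floating-point arithmetic with unit roundoff $u_{QR}$. Assume $$(2\log_2 n+4)\,n^{1/2}\,\widetilde\gamma_{sn}^{(QR)}\,\kappa_2(\widehat Y)<1 \quad\text{and}\quad (2\log_2 n+4)\,n^{1/2}\,\|(\Omega A)^\dagger\|_2\,\|\Delta_s\|_2<1,$$ and put $$\beta=\Bigl(1+18(2\log_2 n+4)\,n^{1/2}\,\widetilde\gamma_{sn}^{(QR)}\,\kappa_2(\Omega A)\Bigr)\Bigl(1+2(2\log_2 n+4)\,n^{1/2}\,\|(\Omega A)^\dagger\|_2\,\|\Delta_s\|_2\Bigr).$$ Then $\widehat R$ is invertible and $$\|\widehat R\|_2\le\beta\,\|\Omega A\|_2,\qquad \|\widehat R^{-1}\|_2\le\beta\,\|(\Omega A)^\dagger\|_2,\qquad \kappa_2(\widehat R)\le\beta^2\,\kappa_2(\Omega A),$$ $$\|A\widehat R^{-1}\|_2\le\beta\,\|AR^{-1}\|_2,\qquad \|(A\widehat R^{-1})^\dagger\|_2\le\beta\,\|(AR^{-1})^\dagger\|_2,\qquad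 \kappa_2(A\widehat R^{-1})\le\beta^2\,\kappa_2(AR^{-1}).$$ Here Householder QR is the following algorithm. At step $k=1,\dots,n$, let $x$ be the part of the current $k$-th column in rows $k,\dots,s$. If $x\ne 0$, compute $\sigma=\operatorname{sign}(x_1)\|x\|_2$ (with $\operatorname{sign}(0)=1$), $v=x+\sigma e_1$ and $\tau=1/(\sigma v_1)$, replace $x$ by $-\sigma e_1$, and replace the part $b$ of each later column in the same rows by $b-(\tau(v^Tb))v$; inner products may be summed in any order. A step may be skipped if the entries of $x$ below its first one are already zero, and is skipped if $x=0$. The leading $n$ rows at the end form $\widehat R$. -/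

import Mathlib

open scoped Matrix Matrix.Norms.L2Operator

/-! From here on `‖M‖` is the spectral norm (the operator 2-norm) of a real matrix. -/

/-- The four Moore-Penrose equations: `X` is the pseudoinverse of `M`. -/
structure IsMoorePenrose {a b : ℕ} (M : Matrix (Fin a) (Fin b) ℝ)
    (X : Matrix (Fin b) (Fin a) ℝ) : Prop where
  mul_mul_self : M * X * M = M
  mul_mul_inv : X * M * X = X
  symm_left : (M * X)ᵀ = M * X
  symm_right : (X * M)ᵀ = X * M

theorem exists_isMoorePenrose {a b : ℕ} (M : Matrix (Fin a) (Fin b) ℝ) :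
    ∃ X, IsMoorePenrose M X := by
  obtain ⟨G, hG1, hG2, hGt, hc⟩ : ∃ G : Matrix (Fin b) (Fin b) ℝ,
      (Mᵀ * M) * G * (Mᵀ * M) = Mᵀ * M ∧ G * (Mᵀ * M) * G = G ∧ Gᵀ = G ∧
        G * (Mᵀ * M) = (Mᵀ * M) * G := by
    have hS : (Mᵀ * M).IsHermitian := by
      simpa using Matrix.isHermitian_conjTranspose_mul_self M
    obtain ⟨U, d, hU, hd⟩ : ∃ (U : Matrix (Fin b) (Fin b) ℝ) (d : Fin b → ℝ),
        Uᵀ * U = 1 ∧ Mᵀ * M = U * Matrix.diagonal d * Uᵀ := by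
      refine ⟨hS.eigenvectorUnitary, hS.eigenvalues, ?_, ?_⟩
      · have := Unitary.coe_star_mul_self hS.eigenvectorUnitary
        simpa [Matrix.star_eq_conjTranspose] using this
      · have := hS.spectral_theorem
        rw [Unitary.conjStarAlgAut_apply] at this
        simpa [Matrix.star_eq_conjTranspose] using this
    have key : ∀ e f : Fin b → ℝ, (U * Matrix.diagonal e * Uᵀ) * (U * Matrix.diagonal f * Uᵀ)
        = U * Matrix.diagonal (fun i => e i * f i) * Uᵀ := by
      intro e f
      calc _ = U * Matrix.diagonal e * (Uᵀ * U) * Matrix.diagonal f * Uᵀ := by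
            simp only [Matrix.mul_assoc]
        _ = _ := by
            rw [hU, Matrix.mul_one, Matrix.mul_assoc U, Matrix.diagonal_mul_diagonal]
    refine ⟨U * Matrix.diagonal (fun i => (d i)⁻¹) * Uᵀ, ?_, ?_, ?_, ?_⟩
    · rw [hd, key, key]
      simp [mul_inv_mul_cancel]
    · rw [hd, key, key]
      congr 3
      funext i
      by_cases h : d i = 0 <;> simp [h]
    · simp [Matrix.transpose_mul, Matrix.mul_assoc]
    · rw [hd, key, key]
      simp [mul_comm]
  refine ⟨G * Mᵀ, ?_, ?_, ?_, ?_⟩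
  · have h : (Mᵀ * M) * (G * (Mᵀ * M) - 1) = 0 := by
      rw [Matrix.mul_sub, ← Matrix.mul_assoc, hG1, Matrix.mul_one, sub_self]
    have h' := (Matrix.conjTranspose_mul_self_mul_eq_zero M (G * (Mᵀ * M) - 1)).1 (by simpa using h)
    rw [Matrix.mul_sub, Matrix.mul_one, sub_eq_zero] at h'
    simpa [Matrix.mul_assoc] using h'
  · calc G * Mᵀ * M * (G * Mᵀ) = (G * (Mᵀ * M) * G) * Mᵀ := by simp only [Matrix.mul_assoc]
      _ = _ := by rw [hG2]
  · simp [Matrix.transpose_mul, hGt, Matrix.mul_assoc]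
  · rw [Matrix.mul_assoc, Matrix.transpose_mul, hGt, Matrix.transpose_mul,
      Matrix.transpose_transpose, hc]

theorem IsMoorePenrose.unique {a b : ℕ} {M : Matrix (Fin a) (Fin b) ℝ}
    {X Z : Matrix (Fin b) (Fin a) ℝ} (hX : IsMoorePenrose M X) (hZ : IsMoorePenrose M Z) :
    X = Z := by
  have h1 : M * X = M * Z := by
    calc M * X = (M * Z) * (M * X) := by rw [← Matrix.mul_assoc, hZ.mul_mul_self]
      _ = (M * Z)ᵀ * (M * X)ᵀ := by rw [hZ.symm_left, hX.symm_left]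
      _ = ((M * X * M) * Z)ᵀ := by rw [← Matrix.transpose_mul]; simp only [Matrix.mul_assoc]
      _ = M * Z := by rw [hX.mul_mul_self, hZ.symm_left]
  have h2 : X * M = Z * M := by
    calc X * M = (X * M) * (Z * M) := by
          rw [Matrix.mul_assoc X, ← Matrix.mul_assoc M, hZ.mul_mul_self]
      _ = (X * M)ᵀ * (Z * M)ᵀ := by rw [hZ.symm_right, hX.symm_right]
      _ = (Z * (M * X * M))ᵀ := by rw [← Matrix.transpose_mul]; simp only [Matrix.mul_assoc]
      _ = Z * M := by rw [hX.mul_mul_self, hZ.symm_right]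
  calc X = X * M * X := hX.mul_mul_inv.symm
    _ = Z * (M * X) := by rw [h2, Matrix.mul_assoc]
    _ = Z := by rw [h1, ← Matrix.mul_assoc, hZ.mul_mul_inv]

/-- The Moore-Penrose pseudoinverse `M†`. -/
noncomputable def pinv {a b : ℕ} (M : Matrix (Fin a) (Fin b) ℝ) : Matrix (Fin b) (Fin a) ℝ :=
  Classical.choose (exists_isMoorePenrose M)

theorem pinv_spec {a b : ℕ} (M : Matrix (Fin a) (Fin b) ℝ) : IsMoorePenrose M (pinv M) :=
  Classical.choose_spec (exists_isMoorePenrose M)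

/-- The 2-norm condition number `κ₂(M) = ‖M‖₂ ‖M†‖₂` of a matrix of full rank. -/
noncomputable def cond2 {a b : ℕ} (M : Matrix (Fin a) (Fin b) ℝ) : ℝ := ‖M‖ * ‖pinv M‖

/-- `M = Q R` is an economic QR decomposition: the columns of `Q` are orthonormal and `R` is
square and upper triangular. -/
structure IsEconomicQR {s n : ℕ} (M Q : Matrix (Fin s) (Fin n) ℝ)
    (R : Matrix (Fin n) (Fin n) ℝ) : Prop where
  orthonormal : Qᵀ * Q = 1
  upper : ∀ i j, j < i → R i j = 0
  eq_mul : M = Q * R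

/-- The quantity `γ̃ₖ = c k u / (1 - c k u)`. -/
noncomputable def gammaTilde (c : ℝ) (k : ℕ) (u : ℝ) : ℝ := c * k * u / (1 - c * k * u)

/-! ### Householder QR in floating point arithmetic

The standard model with unit roundoff `u` (no overflow or underflow): each elementary operation
`+, -, *, /, √` returns its exact result times `1 + δ` for some `|δ| ≤ u`. The `δ`s of different
operations are unrelated, so the predicates below describe every possible outcome of the
algorithm in every arithmetic that obeys the model. Operations without rounding are the
assignments, changes of sign and comparisons. -/

/-- `z` is a possible computed value of an elementary operation with exact result `x`. -/
def FlRound (u x z : ℝ) : Prop := ∃ δ : ℝ, |δ| ≤ u ∧ z = x * (1 + δ)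

/-- `z` is a possible computed value of the sum of a non-empty finite family of numbers, the
additions being carried out in any order. -/
inductive FlSum (u : ℝ) : Multiset ℝ → ℝ → Prop
  | single (x : ℝ) : FlSum u {x} x
  | add {S T : Multiset ℝ} {x y z : ℝ} (hS : FlSum u S x) (hT : FlSum u T y)
      (hz : FlRound u (x + y) z) : FlSum u (S + T) z

/-- `z` is a possible computed value of the inner product `∑ i ≥ p, x i * y i`. -/
def FlDot {s : ℕ} (u : ℝ) (p : Fin s) (x y : Fin s → ℝ) (z : ℝ) : Prop :=
  ∃ w : Fin s → ℝ, (∀ i, p ≤ i → FlRound u (x i * y i) (w i)) ∧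
    FlSum u ((Finset.Ici p).val.map w) z

/-- `v`, `β`, `σ` are possible computed values of the data of the Householder reflection
`I - β v vᵀ` that maps the part `x p, x (p+1), …` of the vector `x` to `-σ e_p`: in exact
arithmetic `σ = sign (x p) (∑ i ≥ p, x i ^ 2) ^ (1/2)`, `v p = x p + σ`, `v i = x i` for `i > p`,
and `β = 1 / (σ * v p)`. -/
def FlHouseholderVec {s : ℕ} (u : ℝ) (p : Fin s) (x v : Fin s → ℝ) (β σ : ℝ) : Prop :=
  (∃ t r : ℝ, FlDot u p x x t ∧ FlRound u (Real.sqrt t) r ∧ σ = if 0 ≤ x p then r else -r) ∧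
  FlRound u (x p + σ) (v p) ∧
  (∀ i, p < i → v i = x i) ∧
  ∃ d : ℝ, FlRound u (σ * v p) d ∧ FlRound u (1 / d) β

/-- `y` is a possible computed value of `(I - β v vᵀ) b = b - (β (vᵀ b)) v`, where `v` is
supported in the rows from `p` on. -/
def FlReflect {s : ℕ} (u : ℝ) (p : Fin s) (v : Fin s → ℝ) (β : ℝ) (b y : Fin s → ℝ) : Prop :=
  (∀ i, i < p → y i = b i) ∧
  ∃ d g : ℝ, FlDot u p v b d ∧ FlRound u (β * d) g ∧
    ∀ i, p ≤ i → ∃ t : ℝ, FlRound u (g * v i) t ∧ FlRound u (b i - t) (y i)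

/-- One step of Householder QR: column `q` of the working matrix `W` is reduced with pivot row
`p`. Either the entries of the column below the pivot are already zero and nothing is done, or
the active part of the column is not zero and a reflection is computed from it and applied to the
later columns, while the column itself is overwritten by its known image `-σ e_p`. -/
def FlHouseholderStep {s n : ℕ} (u : ℝ) (p : Fin s) (q : Fin n)
    (W W' : Matrix (Fin s) (Fin n) ℝ) : Prop :=
  ((∀ i, p < i → W i q = 0) ∧ W' = W) ∨
  ((∃ i, p ≤ i ∧ W i q ≠ 0) ∧ ∃ (v : Fin s → ℝ) (β σ : ℝ),
    FlHouseholderVec u p (fun i => W i q) v β σ ∧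
    (∀ i j, j < q → W' i j = W i j) ∧
    (∀ i, i < p → W' i q = W i q) ∧ W' p q = -σ ∧ (∀ i, p < i → W' i q = 0) ∧
    ∀ j, q < j → FlReflect u p v β (fun i => W i j) (fun i => W' i j))

/-- `R` is a possible computed triangular factor when the economic Householder QR decomposition of
the `s × n` matrix `Y`, `n ≤ s`, is computed with unit roundoff `u`: the leading `n` rows of the
working matrix after the `n` steps. -/
def IsComputedHouseholderR {s n : ℕ} (u : ℝ) (Y : Matrix (Fin s) (Fin n) ℝ)
    (R : Matrix (Fin n) (Fin n) ℝ) : Prop :=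
  ∃ (h : n ≤ s) (W : ℕ → Matrix (Fin s) (Fin n) ℝ), W 0 = Y ∧
    (∀ k : Fin n, FlHouseholderStep u (Fin.castLE h k) k (W k) (W (k + 1))) ∧
    ∀ i j, R i j = W n (Fin.castLE h i) j

/-- The amplification factor
`β = (1 + 18 (2 log₂ n + 4) n^{1/2} γ κ₂(Y)) (1 + 2 (2 log₂ n + 4) n^{1/2} ‖Y†‖₂ ‖Δ‖₂)`. -/
noncomputable def amplification {s n : ℕ} (γ : ℝ) (Y Δ : Matrix (Fin s) (Fin n) ℝ) : ℝ :=
  (1 + 18 * (2 * Real.logb 2 n + 4) * Real.sqrt n * γ * cond2 Y) *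
    (1 + 2 * (2 * Real.logb 2 n + 4) * Real.sqrt n * ‖pinv Y‖ * ‖Δ‖)

/-! ### Pseudoinverses and spectral norms -/

/-! Write `Y = Ω * A`. Columnwise backward stability of Householder QR gives `Y + Δs + E = Q' *
Rhat` with `Q'` having orthonormal columns and `E` small, so `‖Rhat * T‖ = ‖(Y + Δs + E) * T‖` for
every `T`. If `X * M = 1`, then `‖T‖ ≤ ‖X‖ * ‖M * T‖`, so adding `D` to `M` changes `‖M * T‖` by a
factor between `1 - ‖X‖ * ‖D‖` and `1 + ‖X‖ * ‖D‖`. Using this for `Δs` and then for `E` shows that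
`‖Rhat * T‖` and `‖Y * T‖` agree up to the factor `β`, uniformly in `T`.

All the bounds follow by choosing `T` (`preconditioner_bounds`). In particular `‖R * Rhat⁻¹‖ = ‖Y *
Rhat⁻¹‖` and `‖Rhat * R⁻¹‖ = ‖(Y + Δs + E) * R⁻¹‖`, so `R` and `Rhat` are compared without any
perturbation theory for triangular factors; of the factor `2 log₂ n + 4` only the bound `≥ 4`
matters.

The backward error comes from one reflection at a time: a computed step is an exact orthogonal map
plus an error of relative size `100 * η` in each column, with `η` of order `s * u`
(`FlHouseholderStep.exists_orthogonal`). Compounding `n` steps gives `γ̃`, and passing from columns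
to the spectral norm costs `√n`. -/

theorem norm_transpose_mul_self {a b : ℕ} (M : Matrix (Fin a) (Fin b) ℝ) :
    ‖Mᵀ * M‖ = ‖M‖ * ‖M‖ := by
  simpa using Matrix.l2_opNorm_conjTranspose_mul_self M

theorem norm_mul_of_orthonormal {a b d : ℕ} {Q : Matrix (Fin a) (Fin b) ℝ} (hQ : Qᵀ * Q = 1)
    (T : Matrix (Fin b) (Fin d) ℝ) : ‖Q * T‖ = ‖T‖ := by
  have h : ‖Q * T‖ * ‖Q * T‖ = ‖T‖ * ‖T‖ := by
    rw [← norm_transpose_mul_self, ← norm_transpose_mul_self, Matrix.transpose_mul,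
      Matrix.mul_assoc, ← Matrix.mul_assoc Qᵀ, hQ, Matrix.one_mul]
  exact (mul_self_inj (norm_nonneg _) (norm_nonneg _)).1 h

theorem norm_le_one_of_mul_self {a : ℕ} {S : Matrix (Fin a) (Fin a) ℝ} (hS : Sᵀ = S)
    (hSS : S * S = S) : ‖S‖ ≤ 1 := by
  have h := norm_transpose_mul_self S
  rw [hS, hSS] at h
  by_contra! hlt
  nlinarith

theorem norm_one_le {a : ℕ} : ‖(1 : Matrix (Fin a) (Fin a) ℝ)‖ ≤ 1 :=
  norm_le_one_of_mul_self (by simp) (by simp)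

theorem norm_le_one_of_orthonormal {a b : ℕ} {Q : Matrix (Fin a) (Fin b) ℝ} (hQ : Qᵀ * Q = 1) :
    ‖Q‖ ≤ 1 := by
  have h := norm_mul_of_orthonormal hQ (1 : Matrix (Fin b) (Fin b) ℝ)
  rw [Matrix.mul_one] at h
  exact h ▸ norm_one_le

theorem norm_mul_pinv_le {a b : ℕ} (M : Matrix (Fin a) (Fin b) ℝ) : ‖M * pinv M‖ ≤ 1 := by
  refine norm_le_one_of_mul_self (pinv_spec M).symm_left ?_
  rw [← Matrix.mul_assoc, (pinv_spec M).mul_mul_self]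

/-- `pinv M` is any left inverse composed with the orthogonal projection `M * pinv M`, hence the
left inverse of least norm. -/
theorem norm_pinv_le_of_left_inverse {a b : ℕ} {M : Matrix (Fin a) (Fin b) ℝ}
    {X : Matrix (Fin b) (Fin a) ℝ} (h : X * M = 1) : ‖pinv M‖ ≤ ‖X‖ := by
  have hX : pinv M = X * (M * pinv M) := by rw [← Matrix.mul_assoc, h, Matrix.one_mul]
  calc ‖pinv M‖ = ‖X * (M * pinv M)‖ := by rw [← hX]
    _ ≤ ‖X‖ * ‖M * pinv M‖ := Matrix.l2_opNorm_mul _ _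
    _ ≤ ‖X‖ * 1 := by gcongr; exact norm_mul_pinv_le M
    _ = ‖X‖ := mul_one _

/-- Full column rank stated as cancellation, the form that lower bounds on `‖M * T‖` deliver
directly. -/
theorem pinv_mul_self_of_cancel {a b : ℕ} {M : Matrix (Fin a) (Fin b) ℝ}
    (h : ∀ T : Matrix (Fin b) (Fin b) ℝ, M * T = 0 → T = 0) : pinv M * M = 1 := by
  rw [← sub_eq_zero]
  apply h
  rw [Matrix.mul_sub, ← Matrix.mul_assoc, (pinv_spec M).mul_mul_self, Matrix.mul_one, sub_self]

theorem pinv_mul_self_of_left_inverse {a b : ℕ} {M : Matrix (Fin a) (Fin b) ℝ}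
    {X : Matrix (Fin b) (Fin a) ℝ} (h : X * M = 1) : pinv M * M = 1 := by
  refine pinv_mul_self_of_cancel fun T hT => ?_
  rw [← Matrix.one_mul T, ← h, Matrix.mul_assoc, hT, Matrix.mul_zero]

theorem pinv_mul_self_of_rank {a b : ℕ} {M : Matrix (Fin a) (Fin b) ℝ} (h : M.rank = b) :
    pinv M * M = 1 := by
  refine pinv_mul_self_of_cancel fun T hT => ?_
  have hli : LinearIndependent ℝ M.col := by
    rw [linearIndependent_iff_card_eq_finrank_span, Set.finrank,
      ← Matrix.rank_eq_finrank_span_cols, h, Fintype.card_fin]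
  have hinj := Matrix.mulVec_injective_iff.2 hli
  ext i j
  have : T.col j = 0 := by
    apply hinj
    rw [Matrix.mulVec_zero]
    ext k
    have := congrFun (congrFun hT k) j
    simpa [Matrix.mul_apply, Matrix.mulVec, dotProduct] using this
  simpa using congrFun this i

/-! ### Perturbation of matrices of full column rank -/

section Perturbation

variable {s n d : ℕ} {M D : Matrix (Fin s) (Fin n) ℝ} {X : Matrix (Fin n) (Fin s) ℝ} {a : ℝ}

/-- Since `T = X * (M * T)`, the perturbation is small relative to `M * T` itself. Keeping `T`
arbitrary lets such comparisons be chained. -/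
theorem norm_perturbation_mul_le (hX : X * M = 1) (ha : ‖X‖ * ‖D‖ ≤ a)
    (T : Matrix (Fin n) (Fin d) ℝ) : ‖D * T‖ ≤ a * ‖M * T‖ := by
  have hT : T = X * (M * T) := by rw [← Matrix.mul_assoc, hX, Matrix.one_mul]
  calc ‖D * T‖ ≤ ‖D‖ * ‖T‖ := Matrix.l2_opNorm_mul _ _
    _ = ‖D‖ * ‖X * (M * T)‖ := by rw [← hT]
    _ ≤ ‖D‖ * (‖X‖ * ‖M * T‖) := by gcongr; exact Matrix.l2_opNorm_mul _ _
    _ = (‖X‖ * ‖D‖) * ‖M * T‖ := by ring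
    _ ≤ a * ‖M * T‖ := by gcongr

theorem norm_add_mul_le (hX : X * M = 1) (ha : ‖X‖ * ‖D‖ ≤ a) (T : Matrix (Fin n) (Fin d) ℝ) :
    ‖(M + D) * T‖ ≤ (1 + a) * ‖M * T‖ := by
  have h := norm_perturbation_mul_le hX ha T
  rw [Matrix.add_mul]
  linarith [norm_add_le (M * T) (D * T)]

theorem norm_mul_le_of_add (hX : X * M = 1) (ha : ‖X‖ * ‖D‖ ≤ a) (T : Matrix (Fin n) (Fin d) ℝ) :
    (1 - a) * ‖M * T‖ ≤ ‖(M + D) * T‖ := by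
  have h := norm_perturbation_mul_le hX ha T
  have h' := norm_sub_norm_le (M * T) (-(D * T))
  rw [sub_neg_eq_add, norm_neg, ← Matrix.add_mul] at h'
  linarith

theorem pinv_add_mul_self (hX : X * M = 1) (ha : ‖X‖ * ‖D‖ ≤ a) (ha1 : a < 1) :
    pinv (M + D) * (M + D) = 1 := by
  refine pinv_mul_self_of_cancel fun T hT => ?_
  have h := norm_mul_le_of_add hX ha T
  rw [hT, norm_zero] at h
  have h0 : M * T = 0 := norm_le_zero_iff.1 (nonpos_of_mul_nonpos_right h (by linarith))
  rw [← Matrix.one_mul T, ← hX, Matrix.mul_assoc, h0, Matrix.mul_zero]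

/-- The test matrix is `T = pinv (M + D)`: then `(M + D) * T` is an orthogonal projection, so `‖M *
T‖ ≤ 1 / (1 - a)`, and `X` recovers `T` from `M * T`. -/
theorem norm_pinv_add_le (hX : X * M = 1) (ha : ‖X‖ * ‖D‖ ≤ a) (ha1 : a < 1) :
    (1 - a) * ‖pinv (M + D)‖ ≤ ‖X‖ := by
  have h := norm_mul_le_of_add hX ha (pinv (M + D))
  have h1 := norm_mul_pinv_le (M + D)
  have h2 : pinv (M + D) = X * (M * pinv (M + D)) := by
    rw [← Matrix.mul_assoc, hX, Matrix.one_mul]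
  have h3 : ‖pinv (M + D)‖ ≤ ‖X‖ * ‖M * pinv (M + D)‖ := by
    calc _ = ‖X * (M * pinv (M + D))‖ := by rw [← h2]
      _ ≤ _ := Matrix.l2_opNorm_mul _ _
  calc _ ≤ (1 - a) * (‖X‖ * ‖M * pinv (M + D)‖) :=
        mul_le_mul_of_nonneg_left h3 (by linarith)
    _ = ‖X‖ * ((1 - a) * ‖M * pinv (M + D)‖) := by ring
    _ ≤ ‖X‖ * 1 := mul_le_mul_of_nonneg_left (h.trans h1) (norm_nonneg _)
    _ = ‖X‖ := mul_one _

end Perturbation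

/-! ### The Euclidean norm of a coordinate vector -/

/-- The Euclidean norm of a coordinate vector. -/
noncomputable def euclNorm {ι : Type*} [Fintype ι] (x : ι → ℝ) : ℝ := ‖WithLp.toLp 2 x‖

section EuclNorm

variable {ι : Type*} [Fintype ι]

theorem euclNorm_sq (x : ι → ℝ) : euclNorm x ^ 2 = ∑ i, x i ^ 2 := by
  simp [euclNorm, EuclideanSpace.norm_sq_eq]

theorem euclNorm_nonneg (x : ι → ℝ) : 0 ≤ euclNorm x := norm_nonneg _

theorem euclNorm_add_le (x y : ι → ℝ) : euclNorm (x + y) ≤ euclNorm x + euclNorm y := by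
  simpa [euclNorm] using norm_add_le (WithLp.toLp 2 x) (WithLp.toLp 2 y)

theorem euclNorm_smul (a : ℝ) (x : ι → ℝ) : euclNorm (a • x) = |a| * euclNorm x := by
  simpa [euclNorm] using norm_smul a (WithLp.toLp 2 x)

theorem euclNorm_zero : euclNorm (0 : ι → ℝ) = 0 := by
  simp [euclNorm]

theorem euclNorm_abs (x : ι → ℝ) : euclNorm (fun i => |x i|) = euclNorm x := by
  rw [← sq_eq_sq₀ (euclNorm_nonneg _) (euclNorm_nonneg _), euclNorm_sq, euclNorm_sq]
  simp

theorem euclNorm_mono {x y : ι → ℝ} (h : ∀ i, |x i| ≤ y i) : euclNorm x ≤ euclNorm y := by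
  rw [← sq_le_sq₀ (euclNorm_nonneg _) (euclNorm_nonneg _), euclNorm_sq, euclNorm_sq]
  refine Finset.sum_le_sum fun i _ => ?_
  rw [← sq_abs (x i)]
  gcongr
  exact h i

theorem sum_abs_mul_le_euclNorm (x y : ι → ℝ) :
    ∑ i, |x i * y i| ≤ euclNorm x * euclNorm y := by
  refine abs_le_of_sq_le_sq' ?_ (mul_nonneg (euclNorm_nonneg _) (euclNorm_nonneg _)) |>.2
  rw [mul_pow, euclNorm_sq, euclNorm_sq]
  simpa [abs_mul] using Finset.sum_mul_sq_le_sq_mul_sq Finset.univ (fun i => |x i|) fun i => |y i|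

theorem euclNorm_single_le [DecidableEq ι] (p : ι) (a : ℝ) : euclNorm (Pi.single p a) ≤ |a| := by
  rw [← sq_le_sq₀ (euclNorm_nonneg _) (abs_nonneg _), euclNorm_sq, sq_abs]
  rw [Finset.sum_eq_single p] <;> simp +contextual

end EuclNorm

theorem euclNorm_mulVec_le {a b : ℕ} (M : Matrix (Fin a) (Fin b) ℝ) (x : Fin b → ℝ) :
    euclNorm (M *ᵥ x) ≤ ‖M‖ * euclNorm x := by
  simpa [euclNorm] using Matrix.l2_opNorm_mulVec M (WithLp.toLp 2 x)

theorem euclNorm_col_le {a b : ℕ} (M : Matrix (Fin a) (Fin b) ℝ) (j : Fin b) :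
    euclNorm (M.col j) ≤ ‖M‖ := by
  have h := euclNorm_mulVec_le M (Pi.single j 1)
  rw [Matrix.mulVec_single_one] at h
  refine h.trans ?_
  have := euclNorm_single_le j (1 : ℝ)
  rw [abs_one] at this
  exact mul_le_of_le_one_right (norm_nonneg _) this

theorem euclNorm_mulVec_of_orthogonal {a b : ℕ} {P : Matrix (Fin a) (Fin b) ℝ} (hP : Pᵀ * P = 1)
    (x : Fin b → ℝ) : euclNorm (P *ᵥ x) = euclNorm x := by
  rw [← sq_eq_sq₀ (euclNorm_nonneg _) (euclNorm_nonneg _), euclNorm_sq, euclNorm_sq]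
  have h : (P *ᵥ x) ⬝ᵥ (P *ᵥ x) = x ⬝ᵥ x := by
    rw [Matrix.dotProduct_mulVec, Matrix.vecMul_mulVec, hP, Matrix.vecMul_one]
  simpa [dotProduct, sq] using h

theorem norm_le_of_euclNorm_mulVec_le {a b : ℕ} {M : Matrix (Fin a) (Fin b) ℝ} {C : ℝ}
    (hC : 0 ≤ C) (h : ∀ x, euclNorm (M *ᵥ x) ≤ C * euclNorm x) : ‖M‖ ≤ C := by
  rw [Matrix.l2_opNorm_def]
  refine ContinuousLinearMap.opNorm_le_bound _ hC fun x => ?_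
  exact h x.ofLp

/-- The triangle inequality over the columns gives `C * ∑ |x j|`, and Cauchy–Schwarz against the
all-ones vector gives `√b`. This is the source of `n^{1/2}` in the theorem. -/
theorem norm_le_sqrt_mul_of_euclNorm_col_le {a b : ℕ} {M : Matrix (Fin a) (Fin b) ℝ} {C : ℝ}
    (hC : 0 ≤ C) (h : ∀ j, euclNorm (M.col j) ≤ C) : ‖M‖ ≤ Real.sqrt b * C := by
  refine norm_le_of_euclNorm_mulVec_le (by positivity) fun x => ?_
  have hsum : ∀ S : Finset (Fin b), euclNorm (∑ j ∈ S, x j • M.col j) ≤ ∑ j ∈ S, |x j| * C := by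
    intro S
    induction S using Finset.induction_on with
    | empty => simp [euclNorm_zero]
    | insert j S hj ih =>
      rw [Finset.sum_insert hj, Finset.sum_insert hj]
      refine (euclNorm_add_le _ _).trans (add_le_add ?_ ih)
      rw [euclNorm_smul]
      gcongr
      exact h j
  have hcs := sum_abs_mul_le_euclNorm x fun _ => (1 : ℝ)
  have hone : euclNorm (fun _ : Fin b => (1 : ℝ)) = Real.sqrt b := by
    rw [← Real.sqrt_sq (euclNorm_nonneg _), euclNorm_sq]
    simp
  have hM : M *ᵥ x = ∑ j, x j • M.col j := by
    ext i
    simp [Matrix.mulVec, dotProduct, mul_comm]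
  calc euclNorm (M *ᵥ x) ≤ ∑ j, |x j| * C := hM ▸ hsum Finset.univ
    _ = (∑ j, |x j * 1|) * C := by simp [Finset.sum_mul]
    _ ≤ (euclNorm x * Real.sqrt b) * C := by rw [hone] at hcs; gcongr
    _ = _ := by ring

/-! ### Rounding errors -/

/-- `z` approximates `x` with relative error at most `ε`. -/
def RelApprox (ε x z : ℝ) : Prop := |z - x| ≤ ε * |x|

namespace RelApprox

variable {a b x y z w : ℝ}

theorem abs_right_le (h : RelApprox a x y) : |y| ≤ (1 + a) * |x| := by
  have h' : |y - x| ≤ a * |x| := h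
  linarith [abs_sub_abs_le_abs_sub y x]

theorem mono (h : RelApprox a x y) (hab : a ≤ b) : RelApprox b x y :=
  le_trans (show |y - x| ≤ a * |x| from h) (by gcongr)

theorem trans (hb : 0 ≤ b) (h : RelApprox a x y) (h' : RelApprox b y z) :
    RelApprox (a + b + a * b) x z := by
  have h1 : |y - x| ≤ a * |x| := h
  have h2 : |z - y| ≤ b * |y| := h'
  have h3 := mul_le_mul_of_nonneg_left h.abs_right_le hb
  have h4 := abs_sub_le z y x
  change |z - x| ≤ _
  linarith

theorem mul (ha : 0 ≤ a) (h : RelApprox a x y) (h' : RelApprox b z w) :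
    RelApprox (a + b + a * b) (x * z) (y * w) := by
  have h1 : |y - x| ≤ a * |x| := h
  have h2 : |w - z| ≤ b * |z| := h'
  change |y * w - x * z| ≤ _
  calc |y * w - x * z| = |(y - x) * z + y * (w - z)| := by ring_nf
    _ ≤ |(y - x) * z| + |y * (w - z)| := abs_add_le _ _
    _ = |y - x| * |z| + |y| * |w - z| := by rw [abs_mul, abs_mul]
    _ ≤ (a * |x|) * |z| + ((1 + a) * |x|) * (b * |z|) := by
      gcongr
      exact h.abs_right_le
    _ = (a + b + a * b) * |x * z| := by rw [abs_mul]; ring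

theorem one_div (hx : x ≠ 0) (ha1 : a < 1) (h : RelApprox a x y) :
    RelApprox (a / (1 - a)) (1 / x) (1 / y) := by
  have h1 : |y - x| ≤ a * |x| := h
  have hx' : 0 < |x| := abs_pos.2 hx
  have h2 : (1 - a) * |x| ≤ |y| := by
    linarith [abs_sub_abs_le_abs_sub x y, abs_sub_comm x y]
  have h3 : 0 < (1 - a) * |x| := mul_pos (by linarith) hx'
  have hy' : 0 < |y| := h3.trans_le h2
  have hy : y ≠ 0 := abs_pos.1 hy'
  have ha : 0 ≤ a := nonneg_of_mul_nonneg_left ((abs_nonneg _).trans h1) hx'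
  change |1 / y - 1 / x| ≤ _
  have : 1 / y - 1 / x = (x - y) / (y * x) := by field_simp
  rw [this, abs_div, abs_mul, abs_div, abs_one, abs_sub_comm]
  calc |y - x| / (|y| * |x|) ≤ (a * |x|) / (((1 - a) * |x|) * |x|) := by gcongr
    _ = _ := by
      have : 1 - a ≠ 0 := by linarith
      field_simp

/-- `√y - √x = (y - x) / (√y + √x)` with denominator at least `√x`; `a ≤ 1` keeps `y` nonnegative.
-/
theorem sqrt (ha1 : a ≤ 1) (hx : 0 ≤ x) (h : RelApprox a x y) :
    RelApprox a (Real.sqrt x) (Real.sqrt y) := by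
  have h1 : |y - x| ≤ a * |x| := h
  rw [abs_of_nonneg hx] at h1
  have hy : 0 ≤ y := by nlinarith [abs_le.1 h1]
  change |Real.sqrt y - Real.sqrt x| ≤ a * |Real.sqrt x|
  rw [abs_of_nonneg (Real.sqrt_nonneg x)]
  rcases hx.eq_or_lt with rfl | hx
  · have : y = 0 := by simpa using h1
    simp [this]
  · have hsx := Real.sqrt_pos.2 hx
    have hmul : |Real.sqrt y - Real.sqrt x| * (Real.sqrt y + Real.sqrt x) = |y - x| := by
      have hp : 0 ≤ Real.sqrt y + Real.sqrt x := by positivity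
      rw [show ∀ t, |t| * (Real.sqrt y + Real.sqrt x) = |t * (Real.sqrt y + Real.sqrt x)| from
        fun t => by rw [abs_mul, abs_of_nonneg hp]]
      congr 1
      nlinarith [Real.sq_sqrt hx.le, Real.sq_sqrt hy]
    refine le_of_mul_le_mul_right ?_ hsx
    calc |Real.sqrt y - Real.sqrt x| * Real.sqrt x
        ≤ |Real.sqrt y - Real.sqrt x| * (Real.sqrt y + Real.sqrt x) := by
          gcongr
          linarith [Real.sqrt_nonneg y]
      _ ≤ a * x := hmul ▸ h1
      _ = a * Real.sqrt x * Real.sqrt x := by rw [mul_assoc, Real.mul_self_sqrt hx.le]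

end RelApprox

theorem FlRound.relApprox {u x z : ℝ} (h : FlRound u x z) : RelApprox u x z := by
  obtain ⟨δ, hδ, rfl⟩ := h
  change |x * (1 + δ) - x| ≤ _
  rw [show x * (1 + δ) - x = δ * x by ring, abs_mul]
  gcongr

/-- Rounding an approximation of `x` with absolute error `e`. -/
theorem FlRound.abs_sub_le {u x y z e : ℝ} (hu : 0 ≤ u) (h : FlRound u y z) (he : |y - x| ≤ e) :
    |z - x| ≤ e + u * (|x| + e) := by
  have h1 : |z - y| ≤ u * |y| := h.relApprox
  have h2 : |y| ≤ |x| + e := by linarith [abs_sub_abs_le_abs_sub y x]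
  have h3 := mul_le_mul_of_nonneg_left h2 hu
  linarith [_root_.abs_sub_le z y x]

theorem FlSum.one_le_card {u z : ℝ} {S : Multiset ℝ} (h : FlSum u S z) : 1 ≤ S.card := by
  induction h with
  | single x => simp
  | add hS hT hz ihS ihT => rw [Multiset.card_add]; omega

/-- Induction on the summation tree. Both parts of an addition are nonempty, so each has at most
`card - 1` terms and the new rounding uses up the one remaining factor `1 + u`; the order of
summation is irrelevant. -/
theorem FlSum.abs_sub_sum_le {u z : ℝ} (hu : 0 ≤ u) {S : Multiset ℝ} (h : FlSum u S z) :
    |z - S.sum| ≤ ((1 + u) ^ S.card - 1) * (S.map abs).sum := by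
  induction h with
  | single x =>
    simp
    positivity
  | @add S T x y z hS hT hz ihS ihT =>
    have hS1 := hS.one_le_card
    have hT1 := hT.one_le_card
    rw [Multiset.card_add, Multiset.map_add, Multiset.sum_add, Multiset.sum_add]
    have hpos : ∀ U : Multiset ℝ, 0 ≤ (U.map abs).sum := fun U =>
      Multiset.sum_nonneg (by simp +contextual)
    have hpow : ∀ k, k + 1 ≤ S.card + T.card →
        (1 + u) ^ k ≤ (1 + u) ^ (S.card + T.card - 1) := fun k hk =>
      pow_le_pow_right₀ (by linarith) (by omega)
    set E := (1 + u) ^ (S.card + T.card - 1) with hE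
    have hE' : (1 + u) ^ (S.card + T.card) = (1 + u) * E := by
      rw [hE, ← pow_succ']
      congr 1
      omega
    have h1 : |x - S.sum| ≤ (E - 1) * (S.map abs).sum :=
      ihS.trans (mul_le_mul_of_nonneg_right (by linarith [hpow S.card (by omega)]) (hpos S))
    have h2 : |y - T.sum| ≤ (E - 1) * (T.map abs).sum :=
      ihT.trans (mul_le_mul_of_nonneg_right (by linarith [hpow T.card (by omega)]) (hpos T))
    have h3 : |(x + y) - (S.sum + T.sum)| ≤
        (E - 1) * ((S.map abs).sum + (T.map abs).sum) := by
      rw [add_sub_add_comm]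
      linarith [abs_add_le (x - S.sum) (y - T.sum)]
    have h4 := hz.abs_sub_le hu h3
    have h5 : |S.sum + T.sum| ≤ (S.map abs).sum + (T.map abs).sum :=
      (abs_add_le _ _).trans (add_le_add Multiset.abs_sum_le_sum_abs Multiset.abs_sum_le_sum_abs)
    have h6 := mul_le_mul_of_nonneg_left h5 hu
    rw [hE']
    linarith

theorem FlDot.abs_sub_sum_le {s : ℕ} {u z : ℝ} (hu : 0 ≤ u) {p : Fin s} {x y : Fin s → ℝ}
    (h : FlDot u p x y z) :
    |z - ∑ i ∈ Finset.Ici p, x i * y i| ≤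
      ((1 + u) ^ (s + 1) - 1) * ∑ i ∈ Finset.Ici p, |x i * y i| := by
  obtain ⟨w, hw, hz⟩ := h
  have h1 := hz.abs_sub_sum_le hu
  rw [Multiset.card_map, Multiset.map_map] at h1
  change |z - ∑ i ∈ Finset.Ici p, w i| ≤
    ((1 + u) ^ (Finset.Ici p).card - 1) * ∑ i ∈ Finset.Ici p, |w i| at h1
  have hcard : (Finset.Ici p).card ≤ s := by simp
  have hE : (1 + u) ^ (Finset.Ici p).card ≤ (1 + u) ^ s := pow_le_pow_right₀ (by linarith) hcard
  have hE1 : 1 ≤ (1 + u) ^ s := one_le_pow₀ (by linarith)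
  set E := (1 + u) ^ s
  set B := ∑ i ∈ Finset.Ici p, |x i * y i|
  have h2 : |∑ i ∈ Finset.Ici p, w i - ∑ i ∈ Finset.Ici p, x i * y i| ≤ u * B := by
    rw [← Finset.sum_sub_distrib, Finset.mul_sum]
    refine (Finset.abs_sum_le_sum_abs _ _).trans (Finset.sum_le_sum fun i hi => ?_)
    exact (hw i (Finset.mem_Ici.1 hi)).relApprox
  have h3 : ∑ i ∈ Finset.Ici p, |w i| ≤ (1 + u) * B := by
    rw [Finset.mul_sum]
    exact Finset.sum_le_sum fun i hi => (hw i (Finset.mem_Ici.1 hi)).relApprox.abs_right_le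
  have h4 : |z - ∑ i ∈ Finset.Ici p, w i| ≤ (E - 1) * ((1 + u) * B) :=
    h1.trans (mul_le_mul (by linarith) h3 (Finset.sum_nonneg fun _ _ => abs_nonneg _)
      (by linarith))
  rw [pow_succ]
  linarith [_root_.abs_sub_le z (∑ i ∈ Finset.Ici p, w i) (∑ i ∈ Finset.Ici p, x i * y i)]

/-! ### Backward error of Householder QR -/

theorem sum_eq_add_sum_Ioi {s : ℕ} {p : Fin s} {f : Fin s → ℝ} (h : ∀ i, i < p → f i = 0) :
    ∑ i, f i = f p + ∑ i ∈ Finset.Ioi p, f i := by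
  rw [Finset.add_sum_Ioi_eq_sum_Ici]
  symm
  refine Finset.sum_subset (Finset.subset_univ _) fun i _ hi => h i ?_
  simpa using hi

/-- The exact reflector belongs to the same stored column `x`, so exact and computed `σ` take the
same sign. Relative errors accumulate as `η` for the sum of squares, `3η` for `σ`, `5η` for `v p`,
`10η` for `σ * v p` and `14η` for `β`; `η ≤ 1 / 100` absorbs the products of errors. -/
theorem FlHouseholderVec.exists_exact {s : ℕ} {u η : ℝ} (hu : 0 ≤ u) (huη : u ≤ η)
    (hη : (1 + u) ^ (s + 1) - 1 ≤ η) (hη1 : η ≤ 1 / 100) {p : Fin s} {x v' : Fin s → ℝ}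
    {β' σ' : ℝ} (hx : ∃ i, p ≤ i ∧ x i ≠ 0) (h : FlHouseholderVec u p x v' β' σ') :
    ∃ (v : Fin s → ℝ) (β σ : ℝ), (∀ i, i < p → v i = 0) ∧ 0 < β ∧ β * euclNorm v ^ 2 = 2 ∧
      (∀ i, p ≤ i → RelApprox (5 * η) (v i) (v' i)) ∧ RelApprox (14 * η) β β' ∧
      RelApprox (3 * η) σ σ' ∧ |σ| ≤ euclNorm x ∧
      ∀ i, x i - β * (∑ k, v k * x k) * v i =
        if i < p then x i else if i = p then -σ else 0 := by
  obtain ⟨⟨t, r, ht, hr, hσ'⟩, hvp, hv', d, hd, hβ'⟩ := h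
  have hη0 : 0 ≤ η := hu.trans huη
  set S := ∑ i ∈ Finset.Ici p, x i * x i with hS
  have hST : S = x p * x p + ∑ i ∈ Finset.Ioi p, x i * x i :=
    (Finset.add_sum_Ioi_eq_sum_Ici p).symm
  have hSpos : 0 < S := by
    obtain ⟨i, hi, hxi⟩ := hx
    exact Finset.sum_pos' (fun _ _ => mul_self_nonneg _)
      ⟨i, Finset.mem_Ici.2 hi, mul_self_pos.2 hxi⟩
  set N := Real.sqrt S with hN
  have hNpos : 0 < N := Real.sqrt_pos.2 hSpos
  have hNN : N * N = S := Real.mul_self_sqrt hSpos.le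
  obtain ⟨σ, hσ⟩ : ∃ σ, σ = if 0 ≤ x p then N else -N := ⟨_, rfl⟩
  have hσσ : σ * σ = S := by rw [hσ, ← hNN]; split_ifs <;> ring
  have habsσ : |σ| = N := by
    rw [hσ]; split_ifs
    · exact abs_of_pos hNpos
    · rw [abs_neg]; exact abs_of_pos hNpos
  have hD : 0 < σ * (x p + σ) := by
    rw [hσ]; split_ifs with h0 <;> nlinarith
  -- The choice of sign excludes cancellation in `x p + σ`, so a relative error of `σ` is no larger
  -- relative to `x p + σ`.
  have hσle : |σ| ≤ |x p + σ| := by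
    rw [hσ]; split_ifs with h0
    · rw [abs_of_pos hNpos, abs_of_nonneg (by linarith)]; linarith
    · rw [abs_of_neg (by linarith), abs_of_neg (by linarith)]; linarith
  have hrel_t : RelApprox η S t := by
    have := ht.abs_sub_sum_le hu
    have h' : ∑ i ∈ Finset.Ici p, |x i * x i| = |S| := by
      rw [abs_of_pos hSpos, hS]
      exact Finset.sum_congr rfl fun i _ => abs_of_nonneg (mul_self_nonneg _)
    rw [h'] at this
    exact this.trans (by gcongr)
  have hrel_r : RelApprox (3 * η) N r :=
    ((hrel_t.sqrt (by linarith) hSpos.le).trans hu hr.relApprox).mono (by nlinarith)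
  have hrel_σ : RelApprox (3 * η) σ σ' := by
    have hrN : |r - N| ≤ 3 * η * N := by
      have : |r - N| ≤ 3 * η * |N| := hrel_r
      rwa [abs_of_pos hNpos] at this
    change |σ' - σ| ≤ _
    rw [habsσ, hσ, hσ']
    split_ifs
    · exact hrN
    · rwa [show -r - -N = -(r - N) by ring, abs_neg]
  have hrel_vp : RelApprox (5 * η) (x p + σ) (v' p) := by
    have h1 : RelApprox (3 * η) (x p + σ) (x p + σ') := by
      change |x p + σ' - (x p + σ)| ≤ _
      rw [add_sub_add_left_eq_sub]
      exact le_trans (show |σ' - σ| ≤ 3 * η * |σ| from hrel_σ) (by gcongr)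
    exact (h1.trans hu hvp.relApprox).mono (by nlinarith)
  have hrel_d : RelApprox (10 * η) (σ * (x p + σ)) d :=
    ((hrel_σ.mul (by positivity) hrel_vp).trans hu hd.relApprox).mono
      (by nlinarith [mul_nonneg hu hη0, mul_nonneg hη0 hη0, mul_nonneg (mul_nonneg hη0 hη0) hu])
  have hrel_β : RelApprox (14 * η) (1 / (σ * (x p + σ))) β' := by
    have h1 : RelApprox (12 * η) (1 / (σ * (x p + σ))) (1 / d) := by
      refine (hrel_d.one_div hD.ne' (by linarith)).mono ?_
      rw [div_le_iff₀ (by linarith)]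
      nlinarith
    exact (h1.trans hu hβ'.relApprox).mono (by nlinarith)
  set v : Fin s → ℝ := fun i => if i < p then 0 else if i = p then x p + σ else x i with hv
  have hv_lt : ∀ i, i < p → v i = 0 := fun i hi => if_pos hi
  have hv_p : v p = x p + σ := by simp [hv]
  have hv_gt : ∀ i, p < i → v i = x i := fun i hi => by simp [hv, hi.not_gt, hi.ne']
  -- Because `σ * σ = S`, the product `vᵀx` equals `1 / β`: the reflection subtracts exactly `v`
  -- from `x`, leaving `-σ` at the pivot and zeros below. The same identity gives `‖v‖² = 2 / β`.
  have hvx : ∑ k, v k * x k = σ * (x p + σ) := by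
    rw [sum_eq_add_sum_Ioi (p := p) fun i hi => by rw [hv_lt i hi, zero_mul], hv_p,
      Finset.sum_congr rfl fun i hi => by rw [hv_gt i (Finset.mem_Ioi.1 hi)]]
    linarith
  refine ⟨v, 1 / (σ * (x p + σ)), σ, hv_lt, by positivity, ?_, ?_, hrel_β, hrel_σ, ?_, ?_⟩
  · have hvv : euclNorm v ^ 2 = 2 * (σ * (x p + σ)) := by
      rw [euclNorm_sq, sum_eq_add_sum_Ioi (p := p) fun i hi => by
        rw [hv_lt i hi, zero_pow two_ne_zero], hv_p,
        Finset.sum_congr rfl fun i hi => by rw [hv_gt i (Finset.mem_Ioi.1 hi), sq]]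
      linarith
    rw [hvv, mul_left_comm, one_div_mul_cancel hD.ne', mul_one]
  · intro i hi
    rcases hi.eq_or_lt with rfl | hi
    · rwa [hv_p]
    · rw [hv_gt i hi, hv' i hi]
      change |x i - x i| ≤ _
      rw [sub_self, abs_zero]
      positivity
  · rw [habsσ]
    refine abs_le_of_sq_le_sq' ?_ (euclNorm_nonneg x) |>.2
    rw [sq, hNN, euclNorm_sq, hS]
    simp only [sq]
    exact Finset.sum_le_sum_of_subset_of_nonneg (Finset.subset_univ _)
      fun _ _ _ => mul_self_nonneg _
  · intro i
    rw [hvx, one_div_mul_cancel hD.ne', one_mul]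
    rcases lt_trichotomy i p with hi | rfl | hi
    · rw [hv_lt i hi, if_pos hi, sub_zero]
    · rw [hv_p, if_neg (lt_irrefl i), if_pos rfl]
      ring
    · rw [hv_gt i hi, if_neg hi.not_gt, if_neg hi.ne', sub_self]

/-- The inner product `vᵀb` may cancel, so errors are measured against `C = ‖v‖ * ‖b‖` instead of
`|vᵀb|`. The normalisation `β * ‖v‖² = 2` finally turns `β * C * ‖v‖` into `2 * ‖b‖`, for a total of
`71 * η * ‖b‖`. -/
theorem FlReflect.euclNorm_sub_le {s : ℕ} {u η : ℝ} (hu : 0 ≤ u) (huη : u ≤ η)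
    (hη : (1 + u) ^ (s + 1) - 1 ≤ η) (hη1 : η ≤ 1 / 100) {p : Fin s} {v v' b y : Fin s → ℝ}
    {β β' : ℝ} (hv0 : ∀ i, i < p → v i = 0) (hβ : 0 < β) (hβv : β * euclNorm v ^ 2 = 2)
    (hv : ∀ i, p ≤ i → RelApprox (5 * η) (v i) (v' i)) (hβ' : RelApprox (14 * η) β β')
    (h : FlReflect u p v' β' b y) :
    euclNorm (y - (b - (β * ∑ k, v k * b k) • v)) ≤ 100 * η * euclNorm b := by
  obtain ⟨hy0, d', g, hd', hg, hy⟩ := h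
  have hη0 : 0 ≤ η := hu.trans huη
  set D := ∑ k, v k * b k with hD
  set C := euclNorm v * euclNorm b with hC
  have hC0 : 0 ≤ C := mul_nonneg (euclNorm_nonneg _) (euclNorm_nonneg _)
  have hcs : ∑ k, |v k * b k| ≤ C := sum_abs_mul_le_euclNorm v b
  have hDC : |D| ≤ C := (Finset.abs_sum_le_sum_abs _ _).trans hcs
  have hDI : D = ∑ k ∈ Finset.Ici p, v k * b k := by
    rw [hD, sum_eq_add_sum_Ioi (p := p) fun i hi => by rw [hv0 i hi, zero_mul],
      Finset.add_sum_Ioi_eq_sum_Ici (f := fun i => v i * b i) p]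
  have hcsI : ∑ k ∈ Finset.Ici p, |v k * b k| ≤ C :=
    (Finset.sum_le_sum_of_subset_of_nonneg (Finset.subset_univ _)
      fun _ _ _ => abs_nonneg _).trans hcs
  have hd1 : |d' - D| ≤ 7 * η * C := by
    have h1 := hd'.abs_sub_sum_le hu
    have h2 : |∑ k ∈ Finset.Ici p, v' k * b k - D| ≤ 5 * η * C := by
      rw [hDI, ← Finset.sum_sub_distrib]
      refine (Finset.abs_sum_le_sum_abs _ _).trans ?_
      refine le_trans ?_ (mul_le_mul_of_nonneg_left hcsI (by positivity))
      rw [Finset.mul_sum]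
      refine Finset.sum_le_sum fun i hi => ?_
      rw [← sub_mul, abs_mul, abs_mul, ← mul_assoc]
      gcongr
      exact hv i (Finset.mem_Ici.1 hi)
    have h3 : ∑ k ∈ Finset.Ici p, |v' k * b k| ≤ (1 + 5 * η) * C := by
      refine le_trans ?_ (mul_le_mul_of_nonneg_left hcsI (by positivity))
      rw [Finset.mul_sum]
      refine Finset.sum_le_sum fun i hi => ?_
      rw [abs_mul, abs_mul, ← mul_assoc]
      gcongr
      exact (hv i (Finset.mem_Ici.1 hi)).abs_right_le
    have h4 : ((1 + u) ^ (s + 1) - 1) * ∑ k ∈ Finset.Ici p, |v' k * b k| ≤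
        η * ((1 + 5 * η) * C) :=
      mul_le_mul hη h3 (Finset.sum_nonneg fun _ _ => abs_nonneg _) hη0
    have h5 := abs_sub_le d' (∑ k ∈ Finset.Ici p, v' k * b k) D
    have h6 : η * η * C ≤ η * (1 / 100) * C := by gcongr
    nlinarith [mul_nonneg hη0 hC0]
  have hβD : |β * D| ≤ β * C := by
    rw [abs_mul, abs_of_pos hβ]
    gcongr
  have hB0 : 0 ≤ β * C := by positivity
  have hηB : 0 ≤ η * (β * C) := by positivity
  have hηηB : η * (η * (β * C)) ≤ 1 / 100 * (η * (β * C)) := by gcongr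
  have huB : u * (β * C) ≤ η * (β * C) := by gcongr
  have hg1 : |g - β * D| ≤ 24 * η * (β * C) := by
    have h1 : |β' * d' - β * D| ≤ 22 * η * (β * C) := by
      have hb1 : |β' - β| ≤ 14 * η * β := by
        have : |β' - β| ≤ 14 * η * |β| := hβ'
        rwa [abs_of_pos hβ] at this
      have hb2 : |β'| ≤ (1 + 14 * η) * β := by
        have := hβ'.abs_right_le
        rwa [abs_of_pos hβ] at this
      calc |β' * d' - β * D| = |(β' - β) * D + β' * (d' - D)| := by ring_nf
        _ ≤ |β' - β| * |D| + |β'| * |d' - D| := by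
          rw [← abs_mul, ← abs_mul]; exact abs_add_le _ _
        _ ≤ (14 * η * β) * C + ((1 + 14 * η) * β) * (7 * η * C) := by gcongr
        _ ≤ 22 * η * (β * C) := by linarith
    have h2 := hg.abs_sub_le hu h1
    have h3 : u * (|β * D| + 22 * η * (β * C)) ≤ η * (β * C + 22 * η * (β * C)) := by gcongr
    linarith
  -- The `24η` in `g` and `5η` in `v' i` combine to `31η`; rounding the product gives `33η` and the
  -- subtraction `35η`. The subtraction also rounds `b i`, whence the last term.
  have hcomp : ∀ i, |(y - (b - (β * D) • v)) i| ≤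
      (35 * η * (β * C)) * |v i| + η * |b i| := by
    intro i
    simp only [Pi.sub_apply, Pi.smul_apply, smul_eq_mul]
    rcases lt_or_ge i p with hi | hi
    · rw [hy0 i hi, hv0 i hi]
      simp
      positivity
    · obtain ⟨t, ht, hyi⟩ := hy i hi
      set V := |v i| with hV
      have hV0 : 0 ≤ V := abs_nonneg _
      have hBV : 0 ≤ η * (β * C) * V := by positivity
      have hηBV : η * (η * (β * C) * V) ≤ 1 / 100 * (η * (β * C) * V) := by gcongr
      have h1 : |g * v' i - β * D * v i| ≤ 31 * η * (β * C) * V := by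
        calc |g * v' i - β * D * v i| = |(g - β * D) * v' i + β * D * (v' i - v i)| := by ring_nf
          _ ≤ |g - β * D| * |v' i| + |β * D| * |v' i - v i| := by
            rw [← abs_mul, ← abs_mul]; exact abs_add_le _ _
          _ ≤ (24 * η * (β * C)) * ((1 + 5 * η) * V) + (β * C) * (5 * η * V) := by
            gcongr
            · exact (hv i hi).abs_right_le
            · exact hv i hi
          _ ≤ 31 * η * (β * C) * V := by linarith
      have hDv : |β * D * v i| ≤ β * C * V := by
        rw [abs_mul]
        gcongr
      have h2 : |t - β * D * v i| ≤ 33 * η * (β * C) * V := by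
        have := ht.abs_sub_le hu h1
        have h3 : u * (|β * D * v i| + 31 * η * (β * C) * V) ≤
            η * (β * C * V + 31 * η * (β * C) * V) := by gcongr
        linarith
      have h4 : |(b i - t) - (b i - β * D * v i)| ≤ 33 * η * (β * C) * V := by
        rwa [sub_sub_sub_cancel_left, abs_sub_comm]
      have h5 := hyi.abs_sub_le hu h4
      have h6 : |b i - β * D * v i| ≤ |b i| + β * C * V := (abs_sub _ _).trans (by gcongr)
      have h7 : u * (|b i - β * D * v i| + 33 * η * (β * C) * V) ≤
          η * (|b i| + β * C * V + 33 * η * (β * C) * V) := by gcongr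
      linarith
  have hfun : (fun i => (35 * η * (β * C)) * |v i| + η * |b i|) =
      (35 * η * (β * C)) • (fun i => |v i|) + η • fun i => |b i| := rfl
  calc _ ≤ euclNorm fun i => (35 * η * (β * C)) * |v i| + η * |b i| := euclNorm_mono hcomp
    _ ≤ (35 * η * (β * C)) * euclNorm v + η * euclNorm b := by
      rw [hfun]
      refine (euclNorm_add_le _ _).trans_eq ?_
      rw [euclNorm_smul, euclNorm_smul, euclNorm_abs, euclNorm_abs, abs_of_nonneg hη0,
        abs_of_nonneg (by positivity)]
    _ = (35 * η) * (β * euclNorm v ^ 2) * euclNorm b + η * euclNorm b := by rw [hC]; ring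
    _ ≤ 100 * η * euclNorm b := by
      rw [hβv]
      nlinarith [mul_nonneg hη0 (euclNorm_nonneg b)]

/-- The elementary reflector `I - β v vᵀ`. -/
def reflector {s : ℕ} (β : ℝ) (v : Fin s → ℝ) : Matrix (Fin s) (Fin s) ℝ :=
  1 - β • Matrix.vecMulVec v v

theorem reflector_mulVec {s : ℕ} (β : ℝ) (v b : Fin s → ℝ) :
    reflector β v *ᵥ b = b - (β * ∑ k, v k * b k) • v := by
  rw [reflector, Matrix.sub_mulVec, Matrix.one_mulVec, Matrix.smul_mulVec,
    Matrix.vecMulVec_mulVec]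
  ext i
  simp [dotProduct]
  ring

theorem reflector_orthogonal {s : ℕ} {β : ℝ} {v : Fin s → ℝ} (h : β * euclNorm v ^ 2 = 2) :
    (reflector β v)ᵀ * reflector β v = 1 := by
  have hT : (reflector β v)ᵀ = reflector β v := by
    simp [reflector, Matrix.transpose_vecMulVec]
  have hvv : v ⬝ᵥ v = euclNorm v ^ 2 := by
    rw [euclNorm_sq]
    simp [dotProduct, sq]
  rw [hT, reflector, Matrix.sub_mul, Matrix.mul_sub, Matrix.mul_sub, Matrix.one_mul,
    Matrix.one_mul, Matrix.mul_one, Matrix.smul_mul, Matrix.mul_smul,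
    Matrix.vecMulVec_mul_vecMulVec, hvv]
  have : β • β • Matrix.vecMulVec v (euclNorm v ^ 2 • v) = 2 • β • Matrix.vecMulVec v v := by
    ext i j
    simp [Matrix.vecMulVec_apply]
    linear_combination (β * v i * v j) * h
  rw [this]
  module

/-- A single `P` must serve all columns. Earlier columns vanish on the support of `v`, so the exact
reflector fixes them; in the pivot column only `σ` is inexact, as the zeros are assigned; later
columns are handled by `FlReflect.euclNorm_sub_le`. A skipped step has `P = 1`. -/
theorem FlHouseholderStep.exists_orthogonal {s n : ℕ} {u η : ℝ} (hu : 0 ≤ u) (huη : u ≤ η)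
    (hη : (1 + u) ^ (s + 1) - 1 ≤ η) (hη1 : η ≤ 1 / 100) {p : Fin s} {q : Fin n}
    {W W' : Matrix (Fin s) (Fin n) ℝ} (h : FlHouseholderStep u p q W W')
    (hW : ∀ j, j < q → ∀ i, p ≤ i → W i j = 0) :
    (∀ j, j < q → ∀ i, W' i j = W i j) ∧ (∀ i, p < i → W' i q = 0) ∧
    ∃ P : Matrix (Fin s) (Fin s) ℝ, Pᵀ * P = 1 ∧
      ∀ j, euclNorm ((W' - P * W).col j) ≤ 100 * η * euclNorm (W.col j) := by
  have hη0 : 0 ≤ η := hu.trans huη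
  rcases h with ⟨hz, rfl⟩ | ⟨hne, v', β', σ', hvec, hlt, hqlt, hqp, hqgt, hgt⟩
  · refine ⟨fun _ _ _ => rfl, hz, 1, by simp, fun j => ?_⟩
    rw [Matrix.one_mul, sub_self]
    refine (euclNorm_zero (ι := Fin s)).trans_le ?_
    have := euclNorm_nonneg (W'.col j)
    positivity
  · refine ⟨fun j hj i => hlt i j hj, hqgt, ?_⟩
    obtain ⟨v, β, σ, hv0, hβ, hβv, hrelv, hrelβ, hrelσ, hσ, hx⟩ :=
      hvec.exists_exact hu huη hη hη1 hne
    refine ⟨reflector β v, reflector_orthogonal hβv, fun j => ?_⟩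
    have hcol : (W' - reflector β v * W).col j =
        W'.col j - (W.col j - (β * ∑ k, v k * W.col j k) • v) := by
      rw [← reflector_mulVec]
      rfl
    rw [hcol]
    rcases lt_trichotomy j q with hj | rfl | hj
    · have hzero : ∑ k, v k * W.col j k = 0 := by
        refine Finset.sum_eq_zero fun k _ => ?_
        rcases lt_or_ge k p with hk | hk
        · rw [hv0 k hk, zero_mul]
        · rw [Matrix.col_apply, hW j hj k hk, mul_zero]
      have : W'.col j = W.col j := by
        ext i
        exact hlt i j hj
      rw [hzero, this]
      simp only [mul_zero, zero_smul, sub_zero, sub_self, euclNorm_zero]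
      have := euclNorm_nonneg (W.col j)
      positivity
    · have hdiff : W'.col j - (W.col j - (β * ∑ k, v k * W.col j k) • v) =
          Pi.single p (σ - σ') := by
        ext i
        have hxi := hx i
        simp only [Pi.sub_apply, Pi.smul_apply, smul_eq_mul, Matrix.col_apply] at hxi ⊢
        rw [hxi]
        rcases lt_trichotomy i p with hi | rfl | hi
        · rw [if_pos hi, hqlt i hi, Pi.single_eq_of_ne hi.ne, sub_self]
        · rw [if_neg (lt_irrefl i), if_pos rfl, hqp, Pi.single_eq_same]
          ring
        · rw [if_neg hi.not_gt, if_neg hi.ne', hqgt i hi, Pi.single_eq_of_ne hi.ne', sub_self]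
      rw [hdiff]
      refine (euclNorm_single_le _ _).trans ?_
      rw [abs_sub_comm]
      calc |σ' - σ| ≤ 3 * η * |σ| := hrelσ
        _ ≤ 3 * η * euclNorm (W.col j) := by gcongr; exact hσ
        _ ≤ 100 * η * euclNorm (W.col j) := by
          have := euclNorm_nonneg (W.col j)
          gcongr
          norm_num
    · exact (hgt j hj).euclNorm_sub_le hu huη hη hη1 hv0 hβ hβv hrelv hrelβ

/-- Columnwise backward stability of Householder QR. -/
theorem IsComputedHouseholderR.exists_backward {s n : ℕ} {u η : ℝ} (hu : 0 ≤ u) (huη : u ≤ η)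
    (hη : (1 + u) ^ (s + 1) - 1 ≤ η) (hη1 : η ≤ 1 / 100) {Y : Matrix (Fin s) (Fin n) ℝ}
    {R : Matrix (Fin n) (Fin n) ℝ} (h : IsComputedHouseholderR u Y R) :
    ∃ Q E : Matrix (Fin s) (Fin n) ℝ, Qᵀ * Q = 1 ∧ Y + E = Q * R ∧
      ∀ j, euclNorm (E.col j) ≤ ((1 + 100 * η) ^ n - 1) * euclNorm (Y.col j) := by
  obtain ⟨hns, W, hW0, hstep, hR⟩ := h
  have hη0 : 0 ≤ η := hu.trans huη
  have key : ∀ k ≤ n, (∀ (j : Fin n) (i : Fin s), (j : ℕ) < k → (j : ℕ) < i → W k i j = 0) ∧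
      ∃ (O : Matrix (Fin s) (Fin s) ℝ) (E : Matrix (Fin s) (Fin n) ℝ), Oᵀ * O = 1 ∧
        W k = O * (Y + E) ∧
        ∀ j, euclNorm (E.col j) ≤ ((1 + 100 * η) ^ k - 1) * euclNorm (Y.col j) := by
    intro k
    induction k with
    | zero =>
      refine fun _ => ⟨fun _ _ h => absurd h (Nat.not_lt_zero _), 1, 0, by simp, by simp [hW0],
        fun j => ?_⟩
      rw [pow_zero, sub_self, zero_mul]
      exact (euclNorm_zero (ι := Fin s)).le
    | succ k ih =>
      intro hk
      obtain ⟨hz, O, E, hO, hWk, hE⟩ := ih (by omega)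
      obtain ⟨hlt, hq, P, hP, hF⟩ :=
        (hstep ⟨k, hk⟩).exists_orthogonal hu huη hη hη1 fun j hj i hi => by
          have hj' : (j : ℕ) < k := hj
          have hi' : k ≤ (i : ℕ) := hi
          exact hz j i hj' (by omega)
      change ∀ j, j < (⟨k, hk⟩ : Fin n) → ∀ i, W (k + 1) i j = W k i j at hlt
      change ∀ j, euclNorm ((W (k + 1) - P * W k).col j) ≤ 100 * η * euclNorm ((W k).col j) at hF
      -- The local error is pulled back to `Y` by `(P * O)ᵀ`, which preserves column norms. With `e`
      -- the relative error so far, the new one is at most `e + 100 * η * (1 + e)`, so `1 + e` grows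
      -- by the factor `1 + 100 * η`.
      refine ⟨fun j i hj hji => ?_, P * O, E + (P * O)ᵀ * (W (k + 1) - P * W k), ?_, ?_, ?_⟩
      · rcases (Nat.lt_succ_iff.1 hj).lt_or_eq with hj' | hj'
        · rw [hlt j hj' i]
          exact hz j i hj' hji
        · have : j = ⟨k, hk⟩ := Fin.ext hj'
          subst this
          exact hq i hji
      · rw [Matrix.transpose_mul, Matrix.mul_assoc, ← Matrix.mul_assoc Pᵀ, hP, Matrix.one_mul, hO]
      · have hPO : (P * O) * (P * O)ᵀ = 1 := by
          rw [mul_eq_one_comm, Matrix.transpose_mul, Matrix.mul_assoc, ← Matrix.mul_assoc Pᵀ, hP,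
            Matrix.one_mul, hO]
        rw [← add_assoc, Matrix.mul_add, ← Matrix.mul_assoc (P * O), hPO, Matrix.one_mul,
          Matrix.mul_assoc P, ← hWk]
        abel
      · intro j
        have hPO : ((P * O)ᵀ)ᵀ * (P * O)ᵀ = 1 := by
          rw [Matrix.transpose_transpose, mul_eq_one_comm, Matrix.transpose_mul, Matrix.mul_assoc,
            ← Matrix.mul_assoc Pᵀ, hP, Matrix.one_mul, hO]
        have h1 : euclNorm ((W k).col j) ≤ (1 + 100 * η) ^ k * euclNorm (Y.col j) := by
          have h2 : (W k).col j = O *ᵥ (Y.col j + E.col j) := by rw [hWk]; rfl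
          rw [h2, euclNorm_mulVec_of_orthogonal hO]
          linarith [euclNorm_add_le (Y.col j) (E.col j), hE j]
        have h3 : euclNorm (((P * O)ᵀ * (W (k + 1) - P * W k)).col j) ≤
            100 * η * ((1 + 100 * η) ^ k * euclNorm (Y.col j)) := by
          have h4 : ((P * O)ᵀ * (W (k + 1) - P * W k)).col j =
              (P * O)ᵀ *ᵥ (W (k + 1) - P * W k).col j := rfl
          rw [h4, euclNorm_mulVec_of_orthogonal hPO]
          exact (hF j).trans (by gcongr)
        have h5 := euclNorm_add_le (E.col j) (((P * O)ᵀ * (W (k + 1) - P * W k)).col j)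
        refine h5.trans ?_
        rw [pow_succ]
        linarith [hE j]
  obtain ⟨hz, O, E, hO, hWn, hE⟩ := key n le_rfl
  have hO' : O * Oᵀ = 1 := mul_eq_one_comm.1 hO
  -- Only the first `n` columns of `Oᵀ` are kept: rows of `W n` from index `n` on lie below the
  -- diagonal and vanish.
  refine ⟨Oᵀ.submatrix id (Fin.castLE hns), E, ?_, ?_, hE⟩
  · have : (Oᵀ.submatrix id (Fin.castLE hns))ᵀ * Oᵀ.submatrix id (Fin.castLE hns) =
        (O * Oᵀ).submatrix (Fin.castLE hns) (Fin.castLE hns) := by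
      rw [Matrix.submatrix_mul _ _ _ id _ Function.bijective_id]
      rfl
    rw [this, hO', Matrix.submatrix_one _ (Fin.castLE_injective hns)]
  · have hY : Y + E = Oᵀ * W n := by rw [hWn, ← Matrix.mul_assoc, hO, Matrix.one_mul]
    rw [hY]
    ext i j
    rw [Matrix.mul_apply, Matrix.mul_apply]
    have himage : ∑ k : Fin n, Oᵀ i (Fin.castLE hns k) * W n (Fin.castLE hns k) j =
        ∑ k ∈ Finset.univ.map (Fin.castLEEmb hns), Oᵀ i k * W n k j := by
      rw [Finset.sum_map]
      rfl
    simp only [Matrix.submatrix_apply, id, hR]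
    rw [himage]
    symm
    refine Finset.sum_subset (Finset.subset_univ _) fun k _ hk => ?_
    rw [hz j k j.2 ?_, mul_zero]
    by_contra! hkj
    exact hk (Finset.mem_map.2 ⟨⟨k, by omega⟩, Finset.mem_univ _, rfl⟩)

theorem one_add_pow_le_one_div {x : ℝ} (hx : 0 ≤ x) {k : ℕ} (h : k * x < 1) :
    (1 + x) ^ k ≤ 1 / (1 - k * x) := by
  calc (1 + x) ^ k ≤ Real.exp x ^ k := by
        gcongr
        linarith [Real.add_one_le_exp x]
    _ = Real.exp (k * x) := (Real.exp_nat_mul x k).symm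
    _ ≤ 1 / (1 - k * x) := Real.exp_bound_div_one_sub_of_interval (by positivity) h

/-- Backward stability of Householder QR in the spectral norm. -/
theorem IsComputedHouseholderR.exists_backward_norm {s n : ℕ} {u : ℝ} (hn : 1 ≤ n) (hu : 0 ≤ u)
    (hsn : 400 * (s * n : ℕ) * u < 1) {Y : Matrix (Fin s) (Fin n) ℝ}
    {R : Matrix (Fin n) (Fin n) ℝ} (h : IsComputedHouseholderR u Y R) :
    ∃ Q E : Matrix (Fin s) (Fin n) ℝ, Qᵀ * Q = 1 ∧ Y + E = Q * R ∧
      ‖E‖ ≤ Real.sqrt n * (gammaTilde 400 (s * n) u * ‖Y‖) := by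
  have hns : n ≤ s := h.1
  have hn1 : (1 : ℝ) ≤ n := by exact_mod_cast hn
  have hs1 : (1 : ℝ) ≤ s := by exact_mod_cast hn.trans hns
  have hsu : u ≤ s * u := le_mul_of_one_le_left hu hs1
  have hsnu : s * u ≤ s * n * u := by
    rw [mul_right_comm]
    exact le_mul_of_one_le_right (by positivity) hn1
  have hsn' : 400 * (s * n * u) < 1 := by
    push_cast at hsn
    linarith
  -- `(1 + u) ^ (s + 1) - 1 ≤ 2 * (s + 1) * u` and `s + 1 ≤ 2 * s`. With `η = 4 * s * u`, the error
  -- `100 * η` per step over `n` steps yields the constant `c = 400`.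
  have hη : (1 + u) ^ (s + 1) - 1 ≤ 4 * (s * u) := by
    have h1 : ((s + 1 : ℕ) : ℝ) * u ≤ 2 * (s * u) := by
      push_cast
      linarith
    have h0 : 0 ≤ ((s + 1 : ℕ) : ℝ) * u := by positivity
    have h2 := one_add_pow_le_one_div hu (k := s + 1) (by linarith)
    have h3 : 1 / (1 - ((s + 1 : ℕ) : ℝ) * u) ≤ 1 + 2 * (((s + 1 : ℕ) : ℝ) * u) := by
      rw [div_le_iff₀ (by linarith)]
      nlinarith
    linarith
  obtain ⟨Q, E, hQ, hE, hcol⟩ := h.exists_backward hu (by linarith) hη (by linarith)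
  have hγ : (1 + 100 * (4 * (s * u))) ^ n - 1 ≤ gammaTilde 400 (s * n) u := by
    have h1 : (n : ℝ) * (100 * (4 * (s * u))) = 400 * (s * n : ℕ) * u := by
      push_cast
      ring
    have h2 := one_add_pow_le_one_div (x := 100 * (4 * (s * u))) (by positivity) (k := n)
      (by rw [h1]; exact hsn)
    rw [h1] at h2
    refine (sub_le_sub_right h2 1).trans_eq ?_
    have : 1 - 400 * ((s * n : ℕ) : ℝ) * u ≠ 0 := by linarith
    rw [gammaTilde]
    field_simp
    ring
  have hγ0 : 0 ≤ gammaTilde 400 (s * n) u := by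
    refine le_trans ?_ hγ
    have : (1 : ℝ) ≤ (1 + 100 * (4 * (s * u))) ^ n := one_le_pow₀ (by linarith)
    linarith
  refine ⟨Q, E, hQ, hE, norm_le_sqrt_mul_of_euclNorm_col_le (by positivity) fun j => ?_⟩
  exact (hcol j).trans
    (mul_le_mul hγ (euclNorm_col_le Y j) (euclNorm_nonneg _) hγ0)

/-! ### The preconditioned matrix -/

/-- If `‖R' T‖` and `‖Ω A T‖` agree up to a factor `β` for all `T`, then `R'` is as good a
preconditioner as the exact triangular factor of `Ω A`, up to `β`. -/
theorem preconditioner_bounds {m n s : ℕ} {A : Matrix (Fin m) (Fin n) ℝ}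
    {Ω : Matrix (Fin s) (Fin m) ℝ} {Q : Matrix (Fin s) (Fin n) ℝ} {R R' : Matrix (Fin n) (Fin n) ℝ}
    {β : ℝ} (hA : A.rank = n) (hΩA : (Ω * A).rank = n) (hQR : IsEconomicQR (Ω * A) Q R)
    (hβ : 0 ≤ β) (h1 : ∀ T : Matrix (Fin n) (Fin n) ℝ, ‖R' * T‖ ≤ β * ‖Ω * A * T‖)
    (h2 : ∀ T : Matrix (Fin n) (Fin n) ℝ, ‖Ω * A * T‖ ≤ β * ‖R' * T‖) :
    IsUnit R'.det ∧ ‖R'‖ ≤ β * ‖Ω * A‖ ∧ ‖R'⁻¹‖ ≤ β * ‖pinv (Ω * A)‖ ∧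
      cond2 R' ≤ β ^ 2 * cond2 (Ω * A) ∧ ‖A * R'⁻¹‖ ≤ β * ‖A * R⁻¹‖ ∧
      ‖pinv (A * R'⁻¹)‖ ≤ β * ‖pinv (A * R⁻¹)‖ ∧
      cond2 (A * R'⁻¹) ≤ β ^ 2 * cond2 (A * R⁻¹) := by
  have hX := pinv_mul_self_of_rank hΩA
  have hR : IsUnit R.det := by
    refine Matrix.isUnit_det_of_left_inverse (B := pinv (Ω * A) * Q) ?_
    rw [Matrix.mul_assoc, ← hQR.eq_mul, hX]
  have hpR' : pinv R' * R' = 1 := by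
    refine pinv_mul_self_of_cancel fun T hT => ?_
    have h := h2 T
    rw [hT, norm_zero, mul_zero] at h
    rw [← Matrix.one_mul T, ← hX, Matrix.mul_assoc, norm_le_zero_iff.1 h, Matrix.mul_zero]
  have hR' : IsUnit R'.det := Matrix.isUnit_det_of_left_inverse hpR'
  have hinv : R'⁻¹ = pinv R' := Matrix.inv_eq_left_inv hpR'
  have hY : ‖Ω * A * R'⁻¹‖ ≤ β := by
    refine (h2 _).trans ?_
    rw [Matrix.mul_nonsing_inv _ hR']
    exact mul_le_of_le_one_right hβ norm_one_le
  -- `Q` is an isometry, so `R * R'⁻¹` has the norm of `Ω * A * R'⁻¹`.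
  have hRR' : ‖R * R'⁻¹‖ ≤ β := by
    rw [← norm_mul_of_orthonormal hQR.orthonormal, ← Matrix.mul_assoc, ← hQR.eq_mul]
    exact hY
  have hR'R : ‖R' * R⁻¹‖ ≤ β := by
    refine (h1 _).trans ?_
    rw [hQR.eq_mul, Matrix.mul_assoc, Matrix.mul_nonsing_inv _ hR, Matrix.mul_one]
    exact mul_le_of_le_one_right hβ (norm_le_one_of_orthonormal hQR.orthonormal)
  have b1 : ‖R'‖ ≤ β * ‖Ω * A‖ := by simpa using h1 1
  have b2 : ‖R'⁻¹‖ ≤ β * ‖pinv (Ω * A)‖ := by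
    calc ‖R'⁻¹‖ = ‖pinv (Ω * A) * (Ω * A * R'⁻¹)‖ := by
          rw [← Matrix.mul_assoc, hX, Matrix.one_mul]
      _ ≤ ‖pinv (Ω * A)‖ * ‖Ω * A * R'⁻¹‖ := Matrix.l2_opNorm_mul _ _
      _ ≤ ‖pinv (Ω * A)‖ * β := by gcongr
      _ = _ := mul_comm _ _
  have hfac : A * R'⁻¹ = A * R⁻¹ * (R * R'⁻¹) := by
    rw [Matrix.mul_assoc, ← Matrix.mul_assoc R⁻¹, Matrix.nonsing_inv_mul _ hR, Matrix.one_mul]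
  have b3 : ‖A * R'⁻¹‖ ≤ β * ‖A * R⁻¹‖ := by
    calc ‖A * R'⁻¹‖ = ‖A * R⁻¹ * (R * R'⁻¹)‖ := by rw [hfac]
      _ ≤ ‖A * R⁻¹‖ * ‖R * R'⁻¹‖ := Matrix.l2_opNorm_mul _ _
      _ ≤ ‖A * R⁻¹‖ * β := by gcongr
      _ = _ := mul_comm _ _
  have hAR : pinv (A * R⁻¹) * (A * R⁻¹) = 1 := by
    refine pinv_mul_self_of_left_inverse (X := R * pinv A) ?_
    rw [Matrix.mul_assoc, ← Matrix.mul_assoc (pinv A), pinv_mul_self_of_rank hA, Matrix.one_mul,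
      Matrix.mul_nonsing_inv _ hR]
  have b4 : ‖pinv (A * R'⁻¹)‖ ≤ β * ‖pinv (A * R⁻¹)‖ := by
    -- The right-hand matrix is a left inverse of `A * R'⁻¹ = A * R⁻¹ * (R * R'⁻¹)`, and the
    -- pseudoinverse has least norm among these.
    calc ‖pinv (A * R'⁻¹)‖ ≤ ‖(R' * R⁻¹) * pinv (A * R⁻¹)‖ := by
          refine norm_pinv_le_of_left_inverse ?_
          rw [hfac, Matrix.mul_assoc, ← Matrix.mul_assoc (pinv _), hAR, Matrix.one_mul,
            Matrix.mul_assoc, ← Matrix.mul_assoc R⁻¹, Matrix.nonsing_inv_mul _ hR,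
            Matrix.one_mul, Matrix.mul_nonsing_inv _ hR']
      _ ≤ ‖R' * R⁻¹‖ * ‖pinv (A * R⁻¹)‖ := Matrix.l2_opNorm_mul _ _
      _ ≤ β * ‖pinv (A * R⁻¹)‖ := by gcongr
  refine ⟨hR', b1, b2, ?_, b3, b4, ?_⟩
  · rw [hinv] at b2
    calc cond2 R' ≤ (β * ‖Ω * A‖) * (β * ‖pinv (Ω * A)‖) := by
          rw [cond2]; gcongr
      _ = _ := by rw [cond2]; ring
  · calc cond2 (A * R'⁻¹) ≤ (β * ‖A * R⁻¹‖) * (β * ‖pinv (A * R⁻¹)‖) := by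
          rw [cond2]; gcongr
      _ = _ := by rw [cond2]; ring

/-! ### Scalar estimates for the amplification factor and the main theorem. -/

/-- Here `κ` and `κ'` stand for the condition numbers of `Ω * A` and of the computed sketch. From `L
≥ 4` and `r ≥ 1`, both `a` and `b = r * γ * κ'` are below `1 / 4`, hence `κ' ≤ 2 * κ`. The two
factors of the amplification then exceed `1 + 8 * b` and `1 + 8 * a`, and `(1 + 8 * t) * (1 - t) ≥
1` for `0 ≤ t ≤ 7 / 8`. -/
theorem amplification_bounds {L r γ a κ κ' : ℝ} (hL : 4 ≤ L) (hr : 1 ≤ r) (hγ : 0 ≤ γ)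
    (ha : 0 ≤ a) (hκ' : 0 ≤ κ') (h1 : L * r * γ * κ' < 1) (h2 : L * r * a < 1)
    (hκ : (1 - a) * κ' ≤ (1 + a) * κ) :
    r * γ * κ' < 1 ∧
      (1 + a) * (1 + r * γ * κ') ≤ (1 + 18 * L * r * γ * κ) * (1 + 2 * L * r * a) ∧
      1 ≤ (1 + 18 * L * r * γ * κ) * (1 + 2 * L * r * a) * ((1 - a) * (1 - r * γ * κ')) := by
  have hg : 0 ≤ r * γ := by positivity
  have hb : 0 ≤ r * γ * κ' := by positivity
  have ha4 : 4 * a ≤ L * r * a := by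
    gcongr
    nlinarith
  have hb4 : 4 * (r * γ * κ') ≤ L * r * γ * κ' := by nlinarith
  have hκκ : κ' ≤ 2 * κ := by nlinarith
  have hκ0 : 0 ≤ κ := by linarith
  have hP : 1 + 8 * (r * γ * κ') ≤ 1 + 18 * L * r * γ * κ := by
    have e1 : r * γ * κ' ≤ r * γ * (2 * κ) := by gcongr
    have e2 : 4 * (r * γ * κ) ≤ L * (r * γ * κ) := by gcongr
    have e3 : 0 ≤ r * γ * κ := by positivity
    linarith
  have hS : 1 + 8 * a ≤ 1 + 2 * L * r * a := by linarith
  set P := 1 + 18 * L * r * γ * κ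
  set S := 1 + 2 * L * r * a
  set b := r * γ * κ'
  refine ⟨by linarith, ?_, ?_⟩
  · rw [mul_comm]
    exact mul_le_mul (by linarith) (by linarith) (by linarith) (by linarith)
  · have e1 : 1 ≤ P * (1 - b) := by nlinarith
    have e2 : 1 ≤ S * (1 - a) := by nlinarith
    nlinarith

theorem theorem3p1 :
    ∃ c : ℝ, 0 < c ∧
      ∀ (m n s : ℕ) (A : Matrix (Fin m) (Fin n) ℝ) (Ω : Matrix (Fin s) (Fin m) ℝ)
        (Δs Yhat Q : Matrix (Fin s) (Fin n) ℝ) (R Rhat : Matrix (Fin n) (Fin n) ℝ) (uQR : ℝ),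
        1 ≤ n → A.rank = n → (Ω * A).rank = n →
        IsEconomicQR (Ω * A) Q R →
        Yhat = Ω * A + Δs →
        0 ≤ uQR → c * (s * n : ℕ) * uQR < 1 →
        IsComputedHouseholderR uQR Yhat Rhat →
        (2 * Real.logb 2 n + 4) * Real.sqrt n * gammaTilde c (s * n) uQR * cond2 Yhat < 1 →
        (2 * Real.logb 2 n + 4) * Real.sqrt n * ‖pinv (Ω * A)‖ * ‖Δs‖ < 1 →
        IsUnit Rhat.det ∧
        ‖Rhat‖ ≤ amplification (gammaTilde c (s * n) uQR) (Ω * A) Δs * ‖Ω * A‖ ∧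
        ‖Rhat⁻¹‖ ≤ amplification (gammaTilde c (s * n) uQR) (Ω * A) Δs * ‖pinv (Ω * A)‖ ∧
        cond2 Rhat ≤ amplification (gammaTilde c (s * n) uQR) (Ω * A) Δs ^ 2 * cond2 (Ω * A) ∧
        ‖A * Rhat⁻¹‖ ≤ amplification (gammaTilde c (s * n) uQR) (Ω * A) Δs * ‖A * R⁻¹‖ ∧
        ‖pinv (A * Rhat⁻¹)‖ ≤
          amplification (gammaTilde c (s * n) uQR) (Ω * A) Δs * ‖pinv (A * R⁻¹)‖ ∧
        cond2 (A * Rhat⁻¹) ≤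
          amplification (gammaTilde c (s * n) uQR) (Ω * A) Δs ^ 2 * cond2 (A * R⁻¹) := by
  refine ⟨400, by norm_num, ?_⟩
  intro m n s A Ω Δs Yhat Q R Rhat u hn hA hΩA hQR hYhat hu hsn hcomp hγκ hΔ
  subst hYhat
  obtain ⟨Q', E, hQ', hE, hEn⟩ := hcomp.exists_backward_norm hn hu hsn
  have hX := pinv_mul_self_of_rank hΩA
  have hL : 4 ≤ 2 * Real.logb 2 n + 4 := by
    have : 0 ≤ Real.logb 2 (n : ℝ) := Real.logb_nonneg one_lt_two (by exact_mod_cast hn)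
    linarith
  have hr : 1 ≤ Real.sqrt n := Real.one_le_sqrt.2 (by exact_mod_cast hn)
  have hγ0 : 0 ≤ gammaTilde 400 (s * n) u := div_nonneg (by positivity) (by linarith)
  rw [amplification]
  set Y := Ω * A with hYdef
  set γ := gammaTilde 400 (s * n) u
  set L := 2 * Real.logb 2 (n : ℝ) + 4
  set r := Real.sqrt (n : ℝ)
  set a := ‖pinv Y‖ * ‖Δs‖ with ha
  rw [mul_assoc _ ‖pinv Y‖, ← ha] at hΔ
  have ha0 : 0 ≤ a := by positivity
  have ha1 : a < 1 := by
    have : 1 * a ≤ L * r * a := by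
      gcongr
      nlinarith
    linarith
  -- The rounding hypothesis concerns the computed sketch, whereas `β` involves the exact one; this
  -- passes between them.
  have hκ : (1 - a) * cond2 (Y + Δs) ≤ (1 + a) * cond2 Y := by
    have e1 : ‖Y + Δs‖ ≤ (1 + a) * ‖Y‖ := by
      simpa using norm_add_mul_le hX ha.symm.le (1 : Matrix (Fin n) (Fin n) ℝ)
    have e2 := norm_pinv_add_le hX ha.symm.le ha1
    calc (1 - a) * cond2 (Y + Δs) = ‖Y + Δs‖ * ((1 - a) * ‖pinv (Y + Δs)‖) := by
          rw [cond2]; ring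
      _ ≤ ((1 + a) * ‖Y‖) * ‖pinv Y‖ :=
          mul_le_mul e1 e2 (mul_nonneg (by linarith) (norm_nonneg _)) (by positivity)
      _ = _ := by rw [cond2]; ring
  obtain ⟨hb1, hup, hlow⟩ := amplification_bounds (κ' := cond2 (Y + Δs)) hL hr hγ0 ha0
    (mul_nonneg (norm_nonneg _) (norm_nonneg _)) hγκ hΔ hκ
  have hamp : (1 + 18 * L * r * γ * cond2 Y) * (1 + 2 * L * r * ‖pinv Y‖ * ‖Δs‖) =
      (1 + 18 * L * r * γ * cond2 Y) * (1 + 2 * L * r * a) := by rw [ha]; ring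
  rw [hamp]
  set β := (1 + 18 * L * r * γ * cond2 Y) * (1 + 2 * L * r * a)
  set b := r * γ * cond2 (Y + Δs) with hb
  have hb0 : 0 ≤ b := mul_nonneg (by positivity) (mul_nonneg (norm_nonneg _) (norm_nonneg _))
  have hβ0 : 0 ≤ β := le_trans (by positivity) hup
  have hX' := pinv_add_mul_self hX ha.symm.le ha1
  -- The second perturbation starts from `Y + Δs`, so `E` is measured against its pseudoinverse,
  -- which is where `cond2 (Y + Δs)` arises.
  have hbE : ‖pinv (Y + Δs)‖ * ‖E‖ ≤ b := by
    calc _ ≤ ‖pinv (Y + Δs)‖ * (r * (γ * ‖Y + Δs‖)) := by gcongr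
      _ = b := by rw [hb, cond2]; ring
  have hnorm : ∀ T : Matrix (Fin n) (Fin n) ℝ, ‖Rhat * T‖ = ‖(Y + Δs + E) * T‖ := fun T => by
    rw [hE, Matrix.mul_assoc, norm_mul_of_orthonormal hQ']
  refine preconditioner_bounds hA hΩA hQR hβ0 (fun T => ?_) fun T => ?_
  · rw [hnorm]
    calc ‖(Y + Δs + E) * T‖ ≤ (1 + b) * ‖(Y + Δs) * T‖ := norm_add_mul_le hX' hbE T
      _ ≤ (1 + b) * ((1 + a) * ‖Y * T‖) := by
        gcongr
        exact norm_add_mul_le hX ha.symm.le T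
      _ = (1 + a) * (1 + b) * ‖Y * T‖ := by ring
      _ ≤ β * ‖Y * T‖ := by gcongr
  · rw [hnorm]
    calc ‖Y * T‖ ≤ β * ((1 - a) * (1 - b)) * ‖Y * T‖ :=
          le_mul_of_one_le_left (norm_nonneg _) hlow
      _ = β * ((1 - b) * ((1 - a) * ‖Y * T‖)) := by ring
      _ ≤ β * ((1 - b) * ‖(Y + Δs) * T‖) := by
        refine mul_le_mul_of_nonneg_left (mul_le_mul_of_nonneg_left ?_ (by linarith)) hβ0
        exact norm_mul_le_of_add hX ha.symm.le T
      _ ≤ β * ‖(Y + Δs + E) * T‖ :=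
        mul_le_mul_of_nonneg_left (norm_mul_le_of_add hX' hbE T) hβ0
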